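/- Let $S$ be a smooth (Hausdorff, second countable) $k$-dimensional manifold without boundary with a given volume element $ds$ (any Borel measure that is finite on compact sets and positive on non-empty open sets is allowed). Let $T^*\mathrm{Emb}(S,\mathbb R^n)$ be the set of pairs $(Q,P)$ with $Q:S\to\mathbb R^n$ a smooth embedding and $P:S\to(\mathbb R^n)^*$ smooth and compactly supported (no restriction if $S$ is compact). For $N\ge 0$ write points of $T^*\mathrm{Emb}(S,\mathbb R^n)^N$ as $z=(Q^a,P^a)_{a=1}^N$. Let $\mathfrak X(\mathbb R^n)$ be the space of smooth vector fields with its $C^\infty$ topology and the Lie algebra bracket $[X,Y]=(Y\cdot\nabla)X-(X\cdot\nabla)Y$ of the diffeomorphism group (minus the Jacobi–Lie bracket), and $\mathfrak X(\mathbb R^n)^*$ its continuous dual. The singular solution momentum map is $$\mathbf J_{\rm Sing}:T^*\mathrm{Emb}(S,\mathbb R^n)^N\to\mathfrak X(\mathbb R^n)^*,\qquad \langle \mathbf J_{\rm Sing}(z),X\rangle=\sum_{a=1}^N\int_S P^a_i(s)\,X^i(Q^a(s))\,ds,$$ that is, $\mathbf m(x)=\sum_a\int_S P^a(s)\,\delta(x-Q^a(s))\,ds$.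 A curve in $\mathfrak X(\mathbb R^n)^*$ is smooth if its pairing with each vector field is smooth; a curve in $T^*\mathrm{Emb}(S,\mathbb R^n)^N$ is smooth if all $Q^a_t(s),P^a_t(s)$ are smooth in $(t,s)$ and the supports of the $P^a_t$ stay in a common compact set for $t$ in bounded intervals. Call $F:\mathfrak X(\mathbb R^n)^*\to\mathbb R$ smooth if at each $m$ it has a functional derivative $\delta F/\delta m\in\mathfrak X(\mathbb R^n)$, meaning $\frac{d}{dt}F(m_t)=\langle\dot m_t,\frac{\delta F}{\delta m}(m_t)\rangle$ along all smooth curves, and $F$ and $\delta F/\delta m$ are smooth along smooth curves (the latter jointly in $t$ and $x$). Call $F:T^*\mathrm{Emb}(S,\mathbb R^n)^N\to\mathbb R$ smooth if it has functional derivatives, that is, a smooth compactly supported $\delta F/\delta Q^a:S\to(\mathbb R^n)^*$ and a smooth $\delta F/\delta P^a:S\to\mathbb R^n$ with $\frac{d}{dt}F(z_t)=\sum_a\int_S\big(\frac{\delta F}{\delta Q^a}\cdot\partial_tQ^a_t+\partial_tP^a_t\cdot\frac{\delta F}{\delta P^a}\big)ds$ along all smooth curves, and $F$ and its functional derivatives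 are smooth along smooth curves (the latter jointly in $t$ and $s$, with the supports of the $\delta F/\delta Q^a$ in a common compact set for $t$ in bounded intervals). The Lie–Poisson and the canonical brackets are $$\{F,G\}_{LP}(m)=\Big\langle m,\Big[\frac{\delta F}{\delta m},\frac{\delta G}{\delta m}\Big]\Big\rangle,\qquad \{F,G\}_{can}=\sum_{a=1}^N\int_S\Big(\frac{\delta F}{\delta Q^a}\cdot\frac{\delta G}{\delta P^a}-\frac{\delta G}{\delta Q^a}\cdot\frac{\delta F}{\delta P^a}\Big)ds .$$ Then $\mathbf J_{\rm Sing}$ is a Poisson map from the canonical Poisson structure to the Lie–Poisson structure: if $F,G$ are smooth functions on $\mathfrak X(\mathbb R^n)^*$, then $F\circ\mathbf J_{\rm Sing}$ and $G\circ\mathbf J_{\rm Sing}$ are smooth and $$\{F\circ\mathbf J_{\rm Sing},\,G\circ\mathbf J_{\rm Sing}\}_{can}=\{F,G\}_{LP}\circ\mathbf J_{\rm Sing}.$$ In particular, with $\mathbf m=\mathbf J_{\rm Sing}(z)$, $$\{m_i(x),m_j(y)\}_{can}=-\Big(m_j(x)\frac{\partial}{\partial x^i}+\frac{\partial}{\partial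 x^j}m_i(x)\Big)\delta(x-y)$$ in the sense of distributions, i.e. for all smooth $\varphi,\psi:\mathbb R^n\to\mathbb R$, $\{\langle m_i,\varphi\rangle,\langle m_j,\psi\rangle\}_{can}=-\langle m_j,\varphi\,\partial_i\psi\rangle+\langle m_i,\psi\,\partial_j\varphi\rangle$. Consequently, for every smooth Hamiltonian $h$ on $\mathfrak X(\mathbb R^n)^*$, with $H=h\circ\mathbf J_{\rm Sing}$: if a smooth curve $z_t=(Q_t,P_t)$ satisfies, at a time $t$, the canonical Hamiltonian equations $\partial_tQ^a=\delta H/\delta P^a$, $\partial_tP^a=-\delta H/\delta Q^a$, then at that time $m_t=\mathbf J_{\rm Sing}(z_t)$ satisfies the Lie–Poisson equations $\frac{d}{dt}F(m_t)=\{F,h\}_{LP}(m_t)$ for every smooth function $F$ on $\mathfrak X(\mathbb R^n)^*$. -/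

import Mathlib

open Set Filter Topology MeasureTheory Manifold
open scoped ContDiff

noncomputable section

namespace EPDiff

/-! ### The Lie algebra of vector fields, its dual, and the Lie-Poisson bracket -/

/-- The space `ℝⁿ` with its Euclidean structure. -/
abbrev Eucl (n : ℕ) : Type := EuclideanSpace ℝ (Fin n)

/-- Smooth maps `ℝⁿ → ℝⁿ`, as a linear subspace of all maps. -/
def smoothMaps (n : ℕ) : Submodule ℝ (Eucl n → Eucl n) where
  carrier := {X | ContDiff ℝ ∞ X}
  add_mem' {X Y} (hX : ContDiff ℝ ∞ X) (hY : ContDiff ℝ ∞ Y) := hX.add hY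
  zero_mem' := show ContDiff ℝ ∞ (fun _ : Eucl n => (0 : Eucl n)) from contDiff_const
  smul_mem' r X (hX : ContDiff ℝ ∞ X) := hX.const_smul r

/-- The space `𝔛(ℝⁿ)` of smooth vector fields on `ℝⁿ`. -/
def VectField (n : ℕ) : Type := smoothMaps n

namespace VectField

variable {n : ℕ}

instance : AddCommGroup (VectField n) := inferInstanceAs (AddCommGroup (smoothMaps n))

instance : Module ℝ (VectField n) := inferInstanceAs (Module ℝ (smoothMaps n))

instance : CoeFun (VectField n) (fun _ => Eucl n → Eucl n) := ⟨fun X => X.1⟩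

theorem smooth (X : VectField n) : ContDiff ℝ ∞ (fun x => X x) := X.2

/-- The `i`-th derivative of a smooth vector field, as a continuous map. -/
def iterDeriv (i : ℕ) (X : VectField n) :
    C(Eucl n, ContinuousMultilinearMap ℝ (fun _ : Fin i => Eucl n) (Eucl n)) :=
  ⟨iteratedFDeriv ℝ i (fun x => X x),
    X.smooth.continuous_iteratedFDeriv (by exact_mod_cast le_top)⟩

/-- The usual `C^∞` topology: uniform convergence on compact sets of all derivatives. -/
instance : TopologicalSpace (VectField n) :=
  ⨅ i : ℕ, TopologicalSpace.induced (iterDeriv i) inferInstance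

/-- The bracket of `𝔛(ℝⁿ)` as the Lie algebra of the diffeomorphism group: the *negative* of the
Jacobi-Lie bracket of vector fields, that is `[X, Y] = (Y · ∇) X - (X · ∇) Y`. -/
def algBracket (X Y : VectField n) : VectField n :=
  ⟨fun x => - VectorField.lieBracket ℝ (fun y => X y) (fun y => Y y) x, by
    have hX := X.smooth.fderiv_right (m := ∞) le_rfl
    have hY := Y.smooth.fderiv_right (m := ∞) le_rfl
    exact ((hY.clm_apply X.smooth).sub (hX.clm_apply Y.smooth)).neg⟩

/-- The vector field `φ ∂/∂xⁱ`. -/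
def coord (φ : Eucl n → ℝ) (hφ : ContDiff ℝ ∞ φ) (i : Fin n) : VectField n :=
  ⟨fun x => φ x • EuclideanSpace.single i (1 : ℝ), hφ.smul contDiff_const⟩

end VectField

/-- The partial derivative `∂φ/∂xⁱ`. -/
def partialDeriv {n : ℕ} (i : Fin n) (φ : Eucl n → ℝ) (x : Eucl n) : ℝ :=
  fderiv ℝ φ x (EuclideanSpace.single i 1)

theorem contDiff_mul_partialDeriv {n : ℕ} {φ ψ : Eucl n → ℝ} (hψ : ContDiff ℝ ∞ ψ)
    (hφ : ContDiff ℝ ∞ φ) (i : Fin n) :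
    ContDiff ℝ ∞ (fun x => ψ x * partialDeriv i φ x) :=
  hψ.mul ((hφ.fderiv_right (m := ∞) le_rfl).clm_apply contDiff_const)

/-- The dual `𝔛(ℝⁿ)*`: continuous linear functionals on `𝔛(ℝⁿ)`, that is, (compactly supported)
one-form densities with distributional coefficients. -/
abbrev VectDual (n : ℕ) : Type := VectField n →L[ℝ] ℝ

namespace VectDual

variable {n : ℕ}

/-- Smooth curves in `𝔛(ℝⁿ)*`. -/
def IsSmoothCurve (c : ℝ → VectDual n) : Prop :=
  ∀ X : VectField n, ContDiff ℝ ∞ (fun t => c t X)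

/-- `ξ` is the functional derivative `δF/δm` at `m`: along every smooth curve through `m`,
the derivative of `F` is the pairing of the velocity of the curve with `ξ`. -/
def HasFunctionalDerivAt (F : VectDual n → ℝ) (m : VectDual n) (ξ : VectField n) : Prop :=
  ∀ c : ℝ → VectDual n, IsSmoothCurve c → ∀ t : ℝ, c t = m →
    HasDerivAt (fun τ => F (c τ)) (deriv (fun τ => c τ ξ) t) t

open Classical in
/-- The functional derivative `δF/δm` at `m` (zero if there is none). -/
def grad (F : VectDual n → ℝ) (m : VectDual n) : VectField n :=
  if h : ∃ ξ, HasFunctionalDerivAt F m ξ then h.choose else 0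

/-- The smooth functions on `𝔛(ℝⁿ)*`: functions with a functional derivative at each point, such
that the function and its functional derivative are smooth along smooth curves. -/
structure IsSmoothFun (F : VectDual n → ℝ) : Prop where
  exists_grad : ∀ m, ∃ ξ, HasFunctionalDerivAt F m ξ
  smooth : ∀ c, IsSmoothCurve c → ContDiff ℝ ∞ (fun t => F (c t))
  smooth_grad : ∀ c, IsSmoothCurve c →
    ContDiff ℝ ∞ (fun p : ℝ × Eucl n => grad F (c p.1) p.2)

/-- The Lie-Poisson bracket `{F, G}(m) = ⟨m, [δF/δm, δG/δm]⟩`. -/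
def bracket (F G : VectDual n → ℝ) (m : VectDual n) : ℝ :=
  m (VectField.algBracket (grad F m) (grad G m))

end VectDual

/-! ### The cotangent bundle of the space of embeddings and its canonical bracket -/

section Cotangent

variable (k n N : ℕ) (S : Type*) [TopologicalSpace S] [ChartedSpace (EuclideanSpace ℝ (Fin k)) S]

/-- `T* Emb(S, ℝⁿ)`: pairs of a smooth embedding `Q : S → ℝⁿ` and a smooth map `P : S → (ℝⁿ)*`
(a one-form density over `Q`), compactly supported (no condition if `S` is compact). -/
structure CotEmb where
  Q : S → Eucl n
  P : S → (Eucl n →L[ℝ] ℝ)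
  emb : IsSmoothEmbedding (𝓡 k) 𝓘(ℝ, Eucl n) ∞ Q
  smooth_P : ContMDiff (𝓡 k) 𝓘(ℝ, Eucl n →L[ℝ] ℝ) ∞ P
  compact_P : HasCompactSupport P

/-- The phase space of `N` embedded copies of `S`, with variables `(Qᵃ, Pᵃ)`, `a = 1, …, N`;
for `N = 1` this is `T* Emb(S, ℝⁿ)`. -/
abbrev Phase : Type _ := Fin N → CotEmb k n S

variable {k n N S}

namespace Phase

/-- A family `f t a s` is smooth in `(t, s)`. -/
def JointlySmooth (k : ℕ) {S : Type*} [TopologicalSpace S]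
    [ChartedSpace (EuclideanSpace ℝ (Fin k)) S] {N : ℕ} {V : Type*} [NormedAddCommGroup V]
    [NormedSpace ℝ V] (f : ℝ → Fin N → S → V) : Prop :=
  ∀ a, ContMDiff (𝓘(ℝ, ℝ).prod (𝓡 k)) 𝓘(ℝ, V) ∞ (fun p : ℝ × S => f p.1 a p.2)

/-- The supports of `f t a` lie in a common compact set as `t` ranges over a bounded interval. -/
def LocallyCompactSupport {S : Type*} [TopologicalSpace S] {N : ℕ} {V : Type*} [Zero V]
    (f : ℝ → Fin N → S → V) : Prop :=
  ∀ r : ℝ, ∃ K : Set S, IsCompact K ∧ ∀ t ∈ Icc (-r) r, ∀ a, ∀ s ∉ K, f t a s = 0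

/-- Smooth curves in phase space. -/
structure IsSmoothCurve (z : ℝ → Phase k n N S) : Prop where
  smooth_Q : JointlySmooth k (fun t a s => (z t a).Q s)
  smooth_P : JointlySmooth k (fun t a s => (z t a).P s)
  compact_P : LocallyCompactSupport (fun t a s => (z t a).P s)

variable [MeasurableSpace S] (μ : Measure S)

/-- `A = δF/δQ` and `B = δF/δP` are the functional derivatives of `F` at `z`: along every smooth
curve through `z`, the derivative of `F` is `∑ₐ ∫ (δF/δQᵃ · ∂ₜQᵃ + ∂ₜPᵃ · δF/δPᵃ) ds`. -/
structure HasFunctionalDerivAt (F : Phase k n N S → ℝ) (z : Phase k n N S)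
    (A : Fin N → S → (Eucl n →L[ℝ] ℝ)) (B : Fin N → S → Eucl n) : Prop where
  smooth_A : ∀ a, ContMDiff (𝓡 k) 𝓘(ℝ, Eucl n →L[ℝ] ℝ) ∞ (A a)
  compact_A : ∀ a, HasCompactSupport (A a)
  smooth_B : ∀ a, ContMDiff (𝓡 k) 𝓘(ℝ, Eucl n) ∞ (B a)
  hasDerivAt : ∀ c : ℝ → Phase k n N S, IsSmoothCurve c → ∀ t : ℝ, c t = z →
    HasDerivAt (fun τ => F (c τ))
      (∑ a, ∫ s, (A a s (deriv (fun τ => (c τ a).Q s) t)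
        + (deriv (fun τ => (c τ a).P s) t) (B a s)) ∂μ) t

open Classical in
/-- The functional derivative `δF/δQ` at `z` (zero if there is none). -/
def dQ (F : Phase k n N S → ℝ) (z : Phase k n N S) : Fin N → S → (Eucl n →L[ℝ] ℝ) :=
  if h : ∃ A B, HasFunctionalDerivAt μ F z A B then h.choose else 0

open Classical in
/-- The functional derivative `δF/δP` at `z` (zero if there is none). -/
def dP (F : Phase k n N S → ℝ) (z : Phase k n N S) : Fin N → S → Eucl n :=
  if h : ∃ A B, HasFunctionalDerivAt μ F z A B then h.choose_spec.choose else 0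

/-- The smooth functions on phase space: functions with functional derivatives at each point, such
that the function and its functional derivatives are smooth along smooth curves. -/
structure IsSmoothFun (F : Phase k n N S → ℝ) : Prop where
  exists_deriv : ∀ z, ∃ A B, HasFunctionalDerivAt μ F z A B
  smooth : ∀ c, IsSmoothCurve c → ContDiff ℝ ∞ (fun t => F (c t))
  smooth_dQ : ∀ c, IsSmoothCurve c → JointlySmooth k (fun t => dQ μ F (c t))
  compact_dQ : ∀ c, IsSmoothCurve c → LocallyCompactSupport (fun t => dQ μ F (c t))
  smooth_dP : ∀ c, IsSmoothCurve c → JointlySmooth k (fun t => dP μ F (c t))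

/-- The canonical Poisson bracket
`{F, G} = ∑ₐ ∫ (δF/δQᵃ · δG/δPᵃ - δG/δQᵃ · δF/δPᵃ) ds`. -/
def bracket (F G : Phase k n N S → ℝ) (z : Phase k n N S) : ℝ :=
  ∑ a, ∫ s, (dQ μ F z a s (dP μ G z a s) - dQ μ G z a s (dP μ F z a s)) ∂μ

end Phase

end Cotangent

/-! ### The singular solution momentum map -/

section MomentumMap

variable {k n N : ℕ} {S : Type*} [TopologicalSpace S] [ChartedSpace (EuclideanSpace ℝ (Fin k)) S]

theorem CotEmb.continuous_pairing (z : CotEmb k n S) (X : VectField n) :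
    Continuous (fun s => z.P s (X (z.Q s))) :=
  z.smooth_P.continuous.clm_apply (X.smooth.continuous.comp z.emb.contMDiff.continuous)

theorem CotEmb.hasCompactSupport_pairing (z : CotEmb k n S) (X : VectField n) :
    HasCompactSupport (fun s => z.P s (X (z.Q s))) :=
  z.compact_P.mono (fun s hs h => hs (by simp [h]))

variable [MeasurableSpace S] [BorelSpace S] (μ : Measure S) [IsFiniteMeasureOnCompacts μ]

theorem CotEmb.integrable_pairing (z : CotEmb k n S) (X : VectField n) :
    Integrable (fun s => z.P s (X (z.Q s))) μ :=
  (z.continuous_pairing X).integrable_of_hasCompactSupport (z.hasCompactSupport_pairing X)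

/-- The functional `X ↦ ∫ P(s) · X(Q(s)) ds`, that is, the density `∫ P(s) δ(x - Q(s)) ds`. -/
def CotEmb.density (z : CotEmb k n S) : VectDual n where
  toFun X := ∫ s, z.P s (X (z.Q s)) ∂μ
  map_add' X Y := by
    rw [← integral_add (z.integrable_pairing μ X) (z.integrable_pairing μ Y)]
    exact integral_congr_ae (Eventually.of_forall fun s => map_add (z.P s) _ _)
  map_smul' r X := by
    rw [RingHom.id_apply, smul_eq_mul, ← integral_const_mul]
    exact integral_congr_ae (Eventually.of_forall fun s => map_smul (z.P s) r _)
  cont := by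
    have h0 : Continuous (VectField.iterDeriv (n := n) 0) :=
      continuous_iff_le_induced.2 (iInf_le _ 0)
    have h1 : Continuous (fun p : VectField n × S => p.1 (z.Q p.2)) := by
      have h2 : Continuous (fun p : VectField n × S =>
          VectField.iterDeriv 0 p.1 (z.Q p.2) (0 : Fin 0 → Eucl n)) := by
        have h3 : Continuous (fun p : VectField n × S => VectField.iterDeriv 0 p.1 (z.Q p.2)) :=
          (h0.comp continuous_fst).eval (z.emb.contMDiff.continuous.comp continuous_snd)
        exact (ContinuousMultilinearMap.apply ℝ (fun _ : Fin 0 => Eucl n) (Eucl n) 0).continuous.comp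
          h3
      simpa [VectField.iterDeriv] using h2
    have h4 : Continuous (fun p : VectField n × S => z.P p.2 (p.1 (z.Q p.2))) :=
      (z.smooth_P.continuous.comp continuous_snd).clm_apply h1
    rw [← continuousOn_univ]
    refine continuousOn_integral_of_compact_support (k := tsupport z.P) z.compact_P
      h4.continuousOn ?_
    intro X s _ hs
    simp [image_eq_zero_of_notMem_tsupport hs]

/-- The singular solution momentum map `J_Sing`: `m(x) = ∑ₐ ∫ Pᵃ(s) δ(x - Qᵃ(s)) ds`. -/
def JSing (z : Phase k n N S) : VectDual n := ∑ a, (z a).density μ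

end MomentumMap

end EPDiff

end

/-!
The theorem is a computation with functional derivatives, once these are known to be unique; in
`dQ`, `dP` and `grad` they are given by choice.

*The computation.* Along a smooth curve `z_t` in phase space, the pairing
`⟨J_Sing(z_t), X⟩ = ∑ₐ ∫ Pᵃ(X(Qᵃ)) ds` is smooth in `t`, and its derivative is found by
differentiating under the integral sign. So `J_Sing(z_t)` is a smooth curve in the dual, and the
chain rule gives, with `ξ = δF/δm` at `J_Sing(z)`,
`δ(F ∘ J_Sing)/δQᵃ = Pᵃ ∘ Dξ(Qᵃ)` and `δ(F ∘ J_Sing)/δPᵃ = ξ(Qᵃ)`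
(`hasFunctionalDerivAt_comp_JSing`). Inserting this in the canonical bracket gives
`∑ₐ ∫ Pᵃ(Dξ(η) - Dη(ξ))(Qᵃ) ds = ⟨J_Sing(z), [ξ, η]⟩` with `η = δG/δm`, because `[ξ, η]` is the
negative of the Jacobi-Lie bracket (`bracket_comp_JSing`). The formula for `{m_i(x), m_j(y)}` is the
case of linear `F` and `G`, and the statement on the dynamics holds because the right-hand sides of
Hamilton's equations turn the derivative of `F ∘ J_Sing` into a canonical bracket.

*Uniqueness.* In the dual, affine curves realize every velocity, and point evaluations separate
vector fields. In phase space, `δF/δP` is tested on the curves `P + τ W` with `W` a bump function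
times the difference of two candidates. To test `δF/δQ`, one has to move `Q` through embeddings. The
curve used is `ψ_τ ∘ Q` with `ψ_τ = id + ε sin(τ) X`, where `X` is a compactly supported vector field
on `ℝⁿ` and `ε` is so small that each `ψ_τ` is a diffeomorphism (`exists_diffeo_id_add`).
Since `Q` is a topological embedding, a field `X` concentrated near `Q(s₀)` only moves the points
near `s₀`, so that these variations suffice (`HasFunctionalDerivAt.unique_dQ`).
-/

noncomputable section

namespace EPDiff

/-! ### Integrals depending smoothly on a parameter -/

section Parametric

variable {k : ℕ} {S : Type*} [TopologicalSpace S] [ChartedSpace (EuclideanSpace ℝ (Fin k)) S]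

theorem contMDiff_time_slice {V : Type*} [NormedAddCommGroup V] [NormedSpace ℝ V]
    {f : ℝ → S → V}
    (hf : ContMDiff (𝓘(ℝ, ℝ).prod (𝓡 k)) 𝓘(ℝ, V) ∞ (fun p : ℝ × S => f p.1 p.2)) (s : S) :
    ContDiff ℝ ∞ (fun t => f t s) :=
  contMDiff_iff_contDiff.1 (hf.comp (contMDiff_id.prodMk contMDiff_const))

/-- The time derivative of a jointly smooth family is jointly smooth. -/
theorem contMDiff_deriv_time [IsManifold (𝓡 k) ∞ S]
    {V : Type*} [NormedAddCommGroup V] [NormedSpace ℝ V]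
    {f : ℝ → S → V}
    (hf : ContMDiff (𝓘(ℝ, ℝ).prod (𝓡 k)) 𝓘(ℝ, V) ∞ (fun p : ℝ × S => f p.1 p.2)) :
    ContMDiff (𝓘(ℝ, ℝ).prod (𝓡 k)) 𝓘(ℝ, V) ∞
      (fun p : ℝ × S => deriv (fun τ => f τ p.2) p.1) := by
  have h : ContMDiff (𝓘(ℝ, ℝ).prod (𝓡 k)) 𝓘(ℝ, ℝ →L[ℝ] V) ∞
      (fun p : ℝ × S => fderiv ℝ (fun τ => f τ p.2) p.1) := by
    intro p
    have h1 : ContMDiff ((𝓘(ℝ, ℝ).prod (𝓡 k)).prod 𝓘(ℝ, ℝ)) 𝓘(ℝ, V) ∞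
        (Function.uncurry (fun (p : ℝ × S) (τ : ℝ) => f τ p.2)) :=
      hf.comp (contMDiff_snd.prodMk (contMDiff_snd.comp contMDiff_fst))
    have h2 := ContMDiffAt.mfderiv (m := ∞) (fun (p : ℝ × S) (τ : ℝ) => f τ p.2) Prod.fst
      (h1 (p, p.1)) contMDiff_fst.contMDiffAt le_rfl
    simpa [inTangentCoordinates_model_space, mfderiv_eq_fderiv] using h2
  exact (ContinuousLinearMap.apply ℝ V (1 : ℝ)).contMDiff.comp h

/-- Differentiation under the integral sign, for a smooth integrand whose supports stay in a compact
set for bounded times. -/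
theorem hasDerivAt_integral_time [IsManifold (𝓡 k) ∞ S] [T2Space S] [MeasurableSpace S]
    [BorelSpace S] (μ : Measure S) [IsFiniteMeasureOnCompacts μ] {f : ℝ → S → ℝ}
    (hf : ContMDiff (𝓘(ℝ, ℝ).prod (𝓡 k)) 𝓘(ℝ, ℝ) ∞ (fun p : ℝ × S => f p.1 p.2))
    (hK : ∀ r : ℝ, ∃ K : Set S, IsCompact K ∧ ∀ t ∈ Icc (-r) r, ∀ s ∉ K, f t s = 0) (t : ℝ) :
    HasDerivAt (fun τ => ∫ s, f τ s ∂μ) (∫ s, deriv (fun τ => f τ s) t ∂μ) t := by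
  obtain ⟨K, hKc, hK⟩ := hK (|t| + 1)
  have hball : ∀ τ ∈ Metric.ball t 1, τ ∈ Ioo (-(|t| + 1)) (|t| + 1) := by
    intro τ hτ
    rw [Metric.mem_ball, Real.dist_eq] at hτ
    have := abs_lt.1 hτ
    constructor
    · linarith [neg_abs_le t]
    · linarith [le_abs_self t]
  have hcont : ∀ τ, Continuous (f τ) := fun τ =>
    hf.continuous.comp (continuous_const.prodMk continuous_id)
  have hd := contMDiff_deriv_time hf
  have hdc : ∀ τ, Continuous (fun s => deriv (fun τ => f τ s) τ) := fun τ =>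
    hd.continuous.comp (continuous_const.prodMk continuous_id)
  have hd0 : ∀ τ ∈ Metric.ball t 1, ∀ s ∉ K, deriv (fun τ => f τ s) τ = 0 := by
    intro τ hτ s hs
    have : (fun τ => f τ s) =ᶠ[𝓝 τ] fun _ => 0 := by
      filter_upwards [Metric.isOpen_ball.mem_nhds hτ] with σ hσ
      exact hK σ (Ioo_subset_Icc_self (hball σ hσ)) s hs
    rw [this.deriv_eq, deriv_const]
  obtain ⟨M, hM⟩ := ((isCompact_Icc (a := -(|t| + 1)) (b := |t| + 1)).prod
    hKc).exists_bound_of_continuousOn hd.continuous.continuousOn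
  have hcs : ∀ τ ∈ Metric.ball t 1, HasCompactSupport (f τ) := fun τ hτ =>
    HasCompactSupport.intro hKc (hK τ (Ioo_subset_Icc_self (hball τ hτ)))
  have ht : t ∈ Metric.ball t 1 := Metric.mem_ball_self one_pos
  refine (hasDerivAt_integral_of_dominated_loc_of_deriv_le (F := f)
    (F' := fun τ s => deriv (fun τ => f τ s) τ) (bound := K.indicator fun _ => M)
    (Metric.ball_mem_nhds t one_pos) ?_ ?_ ?_ ?_ ?_ ?_).2
  · filter_upwards [Metric.ball_mem_nhds t one_pos] with τ hτ
    exact ((hcont τ).integrable_of_hasCompactSupport (hcs τ hτ)).aestronglyMeasurable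
  · exact (hcont t).integrable_of_hasCompactSupport (hcs t ht)
  · exact ((hdc t).integrable_of_hasCompactSupport
      (HasCompactSupport.intro hKc (hd0 t ht))).aestronglyMeasurable
  · refine Eventually.of_forall fun s τ hτ => ?_
    by_cases hs : s ∈ K
    · rw [indicator_of_mem hs]
      exact hM (τ, s) ⟨Ioo_subset_Icc_self (hball τ hτ), hs⟩
    · rw [indicator_of_notMem hs, hd0 τ hτ s hs, norm_zero]
  · rw [integrable_indicator_iff hKc.measurableSet]
    exact integrableOn_const hKc.measure_lt_top.ne
  · exact Eventually.of_forall fun s τ _ =>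
      ((contMDiff_time_slice hf s).differentiable (by simp)).differentiableAt.hasDerivAt

/-- The hypotheses pass to the time derivative of the integrand, so `hasDerivAt_integral_time` can be
iterated. -/
theorem contDiff_integral_time [IsManifold (𝓡 k) ∞ S] [T2Space S] [MeasurableSpace S]
    [BorelSpace S] (μ : Measure S) [IsFiniteMeasureOnCompacts μ] {f : ℝ → S → ℝ}
    (hf : ContMDiff (𝓘(ℝ, ℝ).prod (𝓡 k)) 𝓘(ℝ, ℝ) ∞ (fun p : ℝ × S => f p.1 p.2))
    (hK : ∀ r : ℝ, ∃ K : Set S, IsCompact K ∧ ∀ t ∈ Icc (-r) r, ∀ s ∉ K, f t s = 0) :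
    ContDiff ℝ ∞ (fun t => ∫ s, f t s ∂μ) := by
  rw [contDiff_infty]
  intro m
  induction m generalizing f with
  | zero =>
    exact contDiff_zero.2 (continuous_iff_continuousAt.2 fun t =>
      (hasDerivAt_integral_time μ hf hK t).continuousAt)
  | succ m ih =>
    have h := hasDerivAt_integral_time μ hf hK
    rw [show ((m + 1 : ℕ) : ℕ∞ω) = (m : ℕ∞ω) + 1 by norm_cast, contDiff_succ_iff_deriv]
    refine ⟨fun t => (h t).differentiableAt, by simp, ?_⟩
    rw [show deriv (fun t => ∫ s, f t s ∂μ) = fun t => ∫ s, deriv (fun τ => f τ s) t ∂μ from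
      funext fun t => (h t).deriv]
    refine ih (contMDiff_deriv_time hf) fun r => ?_
    obtain ⟨K, hKc, hK⟩ := hK (r + 1)
    refine ⟨K, hKc, fun t ht s hs => ?_⟩
    have : (fun τ => f τ s) =ᶠ[𝓝 t] fun _ => 0 := by
      filter_upwards [Ioo_mem_nhds (show -(r + 1) < t by linarith [ht.1])
        (show t < r + 1 by linarith [ht.2])] with σ hσ
      exact hK σ (Ioo_subset_Icc_self hσ) s hs
    rw [this.deriv_eq, deriv_const]

end Parametric

/-! ### Deforming embeddings by diffeomorphisms of the target -/

section Embedding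

/-- A perturbation of the identity by a smooth contraction is a diffeomorphism: it is a homeomorphism
by the contraction principle, and its derivative `1 + DX` is invertible as `‖DX‖ < 1`. -/
theorem exists_diffeo_id_add {E : Type*} [NormedAddCommGroup E] [NormedSpace ℝ E] [CompleteSpace E]
    {X : E → E} (hX : ContDiff ℝ ∞ X) {C : NNReal} (hC : C < 1) (hL : LipschitzWith C X) :
    ∃ ψ : E ≃ₜ E, (∀ x, ψ x = x + X x) ∧ ContDiff ℝ ∞ ψ ∧ ContDiff ℝ ∞ ψ.symm := by
  rcases subsingleton_or_nontrivial E with hE | hE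
  · exact ⟨Homeomorph.refl E, fun x => Subsingleton.elim _ _, contDiff_id, contDiff_id⟩
  have happ : ApproximatesLinearOn (fun x => x + X x)
      ((ContinuousLinearEquiv.refl ℝ E : E ≃L[ℝ] E) : E →L[ℝ] E) univ C := by
    intro x _ y _
    have := hL.norm_sub_le x y
    simpa [add_sub_add_comm] using this
  have hc : Subsingleton E ∨ C < ‖((ContinuousLinearEquiv.refl ℝ E).symm : E →L[ℝ] E)‖₊⁻¹ := by
    right
    have : ((ContinuousLinearEquiv.refl ℝ E).symm : E →L[ℝ] E) = ContinuousLinearMap.id ℝ E := rfl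
    rw [this, ContinuousLinearMap.nnnorm_id, inv_one]
    exact hC
  let ψ := happ.toHomeomorph _ hc
  have hψ : ContDiff ℝ ∞ ψ := contDiff_id.add hX
  have hn : ∀ x, ‖-fderiv ℝ X x‖ < 1 := fun x => by
    rw [norm_neg]
    exact (norm_fderiv_le_of_lipschitz ℝ hL).trans_lt (by exact_mod_cast hC)
  refine ⟨ψ, fun x => rfl, hψ, ?_⟩
  refine ψ.contDiff_symm (f₀' := fun x => ContinuousLinearEquiv.ofUnit (Units.oneSub _ (hn x)))
    (fun x => ?_) hψ
  have h1 : HasFDerivAt X (fderiv ℝ X x) x :=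
    (hX.differentiable (by simp)).differentiableAt.hasFDerivAt
  have h2 : HasFDerivAt ψ (ContinuousLinearMap.id ℝ E + fderiv ℝ X x) x := (hasFDerivAt_id x).add h1
  convert h2 using 1
  ext v
  change ((1 : E →L[ℝ] E) - -fderiv ℝ X x) v = _
  simp

/-- If `f` is an inclusion `u ↦ (u, 0)` in the chart `η` of the target, then so is `ψ ∘ f` in the
chart `η ∘ ψ⁻¹`. -/
theorem comp_diffeo_isSmoothEmbedding {E H M E' : Type*} [NormedAddCommGroup E] [NormedSpace ℝ E]
    [TopologicalSpace H] {I : ModelWithCorners ℝ E H} [TopologicalSpace M] [ChartedSpace H M]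
    [NormedAddCommGroup E'] [NormedSpace ℝ E'] {f : M → E'}
    (hf : IsSmoothEmbedding I 𝓘(ℝ, E') ∞ f) (ψ : E' ≃ₜ E') (hψ : ContDiff ℝ ∞ ψ)
    (hψ' : ContDiff ℝ ∞ ψ.symm) : IsSmoothEmbedding I 𝓘(ℝ, E') ∞ (ψ ∘ f) := by
  refine ⟨?_, ψ.isEmbedding.comp hf.isEmbedding⟩
  obtain ⟨F, _, _, hF⟩ := hf.isImmersion
  refine ⟨F, inferInstance, inferInstance, fun x => ?_⟩
  obtain ⟨φ, η, hx, hfx, hφ, hη, hsub, e, he⟩ := hF x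
  refine ⟨φ, ψ.symm.toOpenPartialHomeomorph ≫ₕ η, hx, by simpa using hfx, hφ, ?_,
    fun y hy => by simpa using hsub hy, e, fun y hy => by simpa using he hy⟩
  rw [IsManifold.maximalAtlas, mem_maximalAtlas_iff] at hη ⊢
  have hψg : ψ.symm.toOpenPartialHomeomorph ∈ contDiffGroupoid ∞ 𝓘(ℝ, E') := by
    rw [contDiffGroupoid, mem_groupoid_of_pregroupoid]
    constructor
    · simpa [contDiffPregroupoid] using hψ'.contDiffOn
    · simpa [contDiffPregroupoid] using hψ.contDiffOn
  have h0 := hη (OpenPartialHomeomorph.refl E') (by simp)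
  intro e' he'
  rw [chartedSpaceSelf_atlas] at he'
  subst he'
  simp only [OpenPartialHomeomorph.refl_trans, OpenPartialHomeomorph.trans_refl,
    OpenPartialHomeomorph.refl_symm] at h0 ⊢
  refine ⟨?_, StructureGroupoid.trans _ hψg h0.2⟩
  rw [OpenPartialHomeomorph.trans_symm_eq_symm_trans_symm]
  exact StructureGroupoid.trans _ h0.1 (StructureGroupoid.symm _ hψg)

end Embedding

/-! ### Functional derivatives on the dual of the vector fields -/

namespace VectDual

variable {n : ℕ}

/-- The functional `X ↦ ℓ (X x)`, i.e. the one-form density `ℓ δ_x`. -/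
def pointEval (x : Eucl n) (ℓ : Eucl n →L[ℝ] ℝ) : VectDual n where
  toFun X := ℓ (X x)
  map_add' _ _ := map_add ℓ _ _
  map_smul' _ _ := map_smul ℓ _ _
  cont := by
    have h0 : Continuous (VectField.iterDeriv (n := n) 0) :=
      continuous_iff_le_induced.2 (iInf_le _ 0)
    have h1 : Continuous (fun X : VectField n => VectField.iterDeriv 0 X x (0 : Fin 0 → Eucl n)) :=
      (ContinuousMultilinearMap.apply ℝ (fun _ : Fin 0 => Eucl n) (Eucl n) 0).continuous.comp
        ((ContinuousEvalConst.continuous_eval_const x).comp h0)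
    exact ℓ.continuous.comp (by simpa [VectField.iterDeriv] using h1)

theorem isSmoothCurve_affine (m η : VectDual n) : IsSmoothCurve (fun t => m + t • η) := by
  intro X
  simp only [add_apply, smul_apply, smul_eq_mul]
  fun_prop

/-- Affine curves reach every velocity, and point evaluations separate vector fields. -/
theorem HasFunctionalDerivAt.unique {F : VectDual n → ℝ} {m : VectDual n} {ξ ξ' : VectField n}
    (h : HasFunctionalDerivAt F m ξ) (h' : HasFunctionalDerivAt F m ξ') : ξ = ξ' := by
  have key : ∀ η : VectDual n, η ξ = η ξ' := by
    intro η
    have hd : ∀ Y : VectField n, deriv (fun τ : ℝ => (m + τ • η) Y) 0 = η Y := by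
      intro Y
      simp
    have h1 := (h _ (isSmoothCurve_affine m η) 0 (by simp)).unique
      (h' _ (isSmoothCurve_affine m η) 0 (by simp))
    rwa [hd, hd] at h1
  refine Subtype.ext (funext fun x => ?_)
  ext i
  exact key (pointEval x (EuclideanSpace.proj i))

theorem IsSmoothFun.hasFunctionalDerivAt {F : VectDual n → ℝ} (hF : IsSmoothFun F)
    (m : VectDual n) : HasFunctionalDerivAt F m (grad F m) := by
  have h := hF.exists_grad m
  rw [grad, dif_pos h]
  exact h.choose_spec

theorem HasFunctionalDerivAt.grad_eq {F : VectDual n → ℝ} {m : VectDual n} {ξ : VectField n}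
    (h : HasFunctionalDerivAt F m ξ) : grad F m = ξ := by
  have h' : ∃ ξ, HasFunctionalDerivAt F m ξ := ⟨ξ, h⟩
  rw [grad, dif_pos h']
  exact h'.choose_spec.unique h

theorem hasFunctionalDerivAt_apply (X : VectField n) (m : VectDual n) :
    HasFunctionalDerivAt (fun m => m X) m X := fun _ hc t _ =>
  ((hc X).differentiable (by simp)).differentiableAt.hasDerivAt (x := t)

theorem grad_apply (X : VectField n) (m : VectDual n) : grad (fun m : VectDual n => m X) m = X :=
  (hasFunctionalDerivAt_apply X m).grad_eq

theorem isSmoothFun_apply (X : VectField n) : IsSmoothFun (fun m : VectDual n => m X) where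
  exists_grad m := ⟨X, hasFunctionalDerivAt_apply X m⟩
  smooth _ hc := hc X
  smooth_grad c _ := by
    simp only [grad_apply]
    exact X.smooth.comp contDiff_snd

end VectDual

theorem VectField.algBracket_apply {n : ℕ} (X Y : VectField n) (x : Eucl n) :
    VectField.algBracket X Y x = fderiv ℝ X x (Y x) - fderiv ℝ Y x (X x) := by
  change -VectorField.lieBracket ℝ (fun y => X y) (fun y => Y y) x = _
  rw [VectorField.lieBracket, neg_sub]

/-! ### Test curves in phase space -/

theorem CotEmb.ext {k n : ℕ} {S : Type*} [TopologicalSpace S]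
    [ChartedSpace (EuclideanSpace ℝ (Fin k)) S] {z w : CotEmb k n S}
    (hQ : z.Q = w.Q) (hP : z.P = w.P) : z = w := by
  cases z
  cases w
  cases hQ
  cases hP
  rfl

namespace Phase

variable {k n N : ℕ} {S : Type*} [TopologicalSpace S] [ChartedSpace (EuclideanSpace ℝ (Fin k)) S]

/-- There is a smooth curve through `z` with `P` fixed whose velocity is a positive multiple of
`X ∘ Qᵃ` in the `a`-th embedding, and zero in the others. -/
theorem exists_curve_moving_Q (z : Phase k n N S) (a : Fin N)
    {X : Eucl n → Eucl n} (hX : ContDiff ℝ ∞ X) {C : NNReal} (hL : LipschitzWith C X) :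
    ∃ δ : ℝ, 0 < δ ∧ ∃ c : ℝ → Phase k n N S, IsSmoothCurve c ∧ c 0 = z ∧
      (∀ b s, deriv (fun τ => (c τ b).Q s) 0 = (Pi.single a δ : Fin N → ℝ) b • X ((z b).Q s)) ∧
      (∀ τ b s, (c τ b).P s = (z b).P s) := by
  -- `sin τ` instead of `τ` keeps the perturbation a contraction for all times `τ ∈ ℝ`.
  set δ : NNReal := (C + 1)⁻¹ with hδ
  have hδpos : 0 < δ := by positivity
  have hδC : δ * C < 1 := by
    rw [hδ, inv_mul_lt_iff₀ (by positivity)]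
    simp
  set ε : Fin N → ℝ := Pi.single a (δ : ℝ) with hε
  have hεle : ∀ b, |ε b| ≤ δ := by
    intro b
    by_cases hb : b = a
    · subst hb; simp [hε]
    · simp [hε, hb]
  have hlip : ∀ (τ : ℝ) (b : Fin N),
      LipschitzWith (δ * C) (fun x => (ε b * Real.sin τ) • X x) := by
    intro τ b
    refine LipschitzWith.of_dist_le_mul fun x y => ?_
    rw [dist_smul₀, NNReal.coe_mul, mul_assoc]
    refine mul_le_mul ?_ (hL.dist_le_mul x y) dist_nonneg δ.2
    rw [Real.norm_eq_abs, abs_mul]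
    calc |ε b| * |Real.sin τ| ≤ δ * 1 :=
          mul_le_mul (hεle b) (Real.abs_sin_le_one τ) (abs_nonneg _) δ.2
      _ = δ := mul_one _
  choose ψ hψ hψs hψs' using fun (τ : ℝ) (b : Fin N) =>
    exists_diffeo_id_add (hX.const_smul (ε b * Real.sin τ)) hδC (hlip τ b)
  let c : ℝ → Phase k n N S := fun τ b =>
    { Q := ψ τ b ∘ (z b).Q
      P := (z b).P
      emb := comp_diffeo_isSmoothEmbedding (z b).emb (ψ τ b) (hψs τ b) (hψs' τ b)
      smooth_P := (z b).smooth_P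
      compact_P := (z b).compact_P }
  have hcQ : ∀ τ b s, (c τ b).Q s = (z b).Q s + (ε b * Real.sin τ) • X ((z b).Q s) :=
    fun τ b s => hψ τ b _
  refine ⟨δ, hδpos, c, ⟨?_, ?_, ?_⟩, ?_, ?_, fun _ _ _ => rfl⟩
  · intro b
    simp only [hcQ]
    have hQ : ContMDiff (𝓘(ℝ, ℝ).prod (𝓡 k)) 𝓘(ℝ, Eucl n) ∞ (fun p : ℝ × S => (z b).Q p.2) :=
      (z b).emb.contMDiff.comp contMDiff_snd
    have hsin : ContMDiff (𝓘(ℝ, ℝ).prod (𝓡 k)) 𝓘(ℝ, ℝ) ∞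
        (fun p : ℝ × S => ε b * Real.sin p.1) :=
      (contDiff_const.mul Real.contDiff_sin).contMDiff.comp contMDiff_fst
    exact hQ.add (hsin.smul (hX.contMDiff.comp hQ))
  · exact fun b => (z b).smooth_P.comp contMDiff_snd
  · intro r
    refine ⟨⋃ b, tsupport (z b).P, isCompact_iUnion fun b => (z b).compact_P, ?_⟩
    intro t _ b s hs
    exact image_eq_zero_of_notMem_tsupport fun h => hs (mem_iUnion.2 ⟨b, h⟩)
  · funext b
    refine CotEmb.ext (funext fun s => ?_) rfl
    rw [hcQ]
    simp
  · intro b s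
    simp only [hcQ]
    have h1 : HasDerivAt (fun τ => ε b * Real.sin τ) (ε b) 0 := by
      simpa using (Real.hasDerivAt_sin 0).const_mul (ε b)
    exact ((h1.smul_const (X ((z b).Q s))).const_add _).deriv

/-- There is a smooth curve through `z` with `Q` fixed whose velocity is `W` in the `a`-th momentum,
and zero in the others. -/
theorem exists_curve_moving_P (z : Phase k n N S) (a : Fin N) {W : S → (Eucl n →L[ℝ] ℝ)}
    (hW : ContMDiff (𝓡 k) 𝓘(ℝ, Eucl n →L[ℝ] ℝ) ∞ W) (hWc : HasCompactSupport W) :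
    ∃ c : ℝ → Phase k n N S, IsSmoothCurve c ∧ c 0 = z ∧
      (∀ τ b s, (c τ b).Q s = (z b).Q s) ∧
      (∀ b s, deriv (fun τ => (c τ b).P s) 0 = (Pi.single a 1 : Fin N → ℝ) b • W s) := by
  set ε : Fin N → ℝ := Pi.single a 1 with hε
  have hsupp : ∀ (τ : ℝ) (b : Fin N), ∀ s ∉ (⋃ b, tsupport (z b).P) ∪ tsupport W,
      (z b).P s + (ε b * τ) • W s = 0 := by
    intro τ b s hs
    rw [mem_union, not_or, mem_iUnion, not_exists] at hs
    rw [image_eq_zero_of_notMem_tsupport (hs.1 b), image_eq_zero_of_notMem_tsupport hs.2]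
    simp
  have hcomp : IsCompact ((⋃ b, tsupport (z b).P) ∪ tsupport W) :=
    (isCompact_iUnion fun b => (z b).compact_P).union hWc
  have hclosed : IsClosed ((⋃ b, tsupport (z b).P) ∪ tsupport W) :=
    (isClosed_iUnion_of_finite fun b => isClosed_tsupport _).union (isClosed_tsupport _)
  have hsm : ∀ b, ContMDiff (𝓘(ℝ, ℝ).prod (𝓡 k)) 𝓘(ℝ, Eucl n →L[ℝ] ℝ) ∞
      (fun p : ℝ × S => (z b).P p.2 + (ε b * p.1) • W p.2) := by
    intro b
    have h1 : ContMDiff (𝓘(ℝ, ℝ).prod (𝓡 k)) 𝓘(ℝ, ℝ) ∞ (fun p : ℝ × S => ε b * p.1) :=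
      (contDiff_const.mul contDiff_id).contMDiff.comp contMDiff_fst
    exact ((z b).smooth_P.comp contMDiff_snd).add (h1.smul (hW.comp contMDiff_snd))
  let c : ℝ → Phase k n N S := fun τ b =>
    { Q := (z b).Q
      P := fun s => (z b).P s + (ε b * τ) • W s
      emb := (z b).emb
      smooth_P := (hsm b).comp (contMDiff_const.prodMk contMDiff_id)
      compact_P := hcomp.of_isClosed_subset (isClosed_tsupport _)
        (closure_minimal (fun s hs => by_contra fun h => hs (hsupp τ b s h)) hclosed) }
  refine ⟨c, ⟨fun b => (z b).emb.contMDiff.comp contMDiff_snd, hsm, fun r => ⟨_, hcomp,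
    fun t _ b s hs => hsupp t b s hs⟩⟩, ?_, fun _ _ _ => rfl, ?_⟩
  · funext b
    refine CotEmb.ext rfl (funext fun s => ?_)
    change (z b).P s + (ε b * 0) • W s = (z b).P s
    simp
  · intro b s
    change deriv (fun τ => (z b).P s + (ε b * τ) • W s) 0 = _
    have h1 : HasDerivAt (fun τ => ε b * τ) (ε b) 0 := by
      simpa using (hasDerivAt_id (0 : ℝ)).const_mul (ε b)
    exact ((h1.smul_const (W s)).const_add _).deriv

end Phase

/-! ### Uniqueness of functional derivatives on phase space -/

namespace Phase

variable {k n N : ℕ} {S : Type*} [TopologicalSpace S] [ChartedSpace (EuclideanSpace ℝ (Fin k)) S]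
  [MeasurableSpace S] {μ : Measure S}

theorem HasFunctionalDerivAt.integral_eq_of_moving_Q {F : Phase k n N S → ℝ} {z : Phase k n N S}
    {A : Fin N → S → (Eucl n →L[ℝ] ℝ)} {B : Fin N → S → Eucl n}
    {A' : Fin N → S → (Eucl n →L[ℝ] ℝ)} {B' : Fin N → S → Eucl n}
    (h : HasFunctionalDerivAt μ F z A B) (h' : HasFunctionalDerivAt μ F z A' B') (a : Fin N)
    {X : Eucl n → Eucl n} (hX : ContDiff ℝ ∞ X) {C : NNReal} (hL : LipschitzWith C X) :
    ∫ s, A a s (X ((z a).Q s)) ∂μ = ∫ s, A' a s (X ((z a).Q s)) ∂μ := by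
  obtain ⟨δ, hδ, c, hc, hc0, hcQ, hcP⟩ := exists_curve_moving_Q z a hX hL
  have hu := (h.hasDerivAt c hc 0 hc0).unique (h'.hasDerivAt c hc 0 hc0)
  have key : ∀ (A : Fin N → S → (Eucl n →L[ℝ] ℝ)) (B : Fin N → S → Eucl n),
      (∑ b, ∫ s, (A b s (deriv (fun τ => (c τ b).Q s) 0)
        + (deriv (fun τ => (c τ b).P s) 0) (B b s)) ∂μ) = δ * ∫ s, A a s (X ((z a).Q s)) ∂μ := by
    intro A B
    simp only [hcQ, hcP, deriv_const, zero_apply, add_zero, map_smul, smul_eq_mul,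
      integral_const_mul]
    rw [Finset.sum_eq_single a (fun b _ hb => by simp [hb]) (by simp)]
    simp
  rw [key, key] at hu
  exact mul_left_cancel₀ hδ.ne' hu

theorem HasFunctionalDerivAt.integral_eq_of_moving_P {F : Phase k n N S → ℝ} {z : Phase k n N S}
    {A : Fin N → S → (Eucl n →L[ℝ] ℝ)} {B : Fin N → S → Eucl n}
    {A' : Fin N → S → (Eucl n →L[ℝ] ℝ)} {B' : Fin N → S → Eucl n}
    (h : HasFunctionalDerivAt μ F z A B) (h' : HasFunctionalDerivAt μ F z A' B') (a : Fin N)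
    {W : S → (Eucl n →L[ℝ] ℝ)}
    (hW : ContMDiff (𝓡 k) 𝓘(ℝ, Eucl n →L[ℝ] ℝ) ∞ W) (hWc : HasCompactSupport W) :
    ∫ s, W s (B a s) ∂μ = ∫ s, W s (B' a s) ∂μ := by
  obtain ⟨c, hc, hc0, hcQ, hcP⟩ := exists_curve_moving_P z a hW hWc
  have hu := (h.hasDerivAt c hc 0 hc0).unique (h'.hasDerivAt c hc 0 hc0)
  have key : ∀ (A : Fin N → S → (Eucl n →L[ℝ] ℝ)) (B : Fin N → S → Eucl n),
      (∑ b, ∫ s, (A b s (deriv (fun τ => (c τ b).Q s) 0)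
        + (deriv (fun τ => (c τ b).P s) 0) (B b s)) ∂μ) = ∫ s, W s (B a s) ∂μ := by
    intro A B
    simp only [hcQ, hcP, deriv_const, map_zero, zero_add, smul_apply, smul_eq_mul,
      integral_const_mul]
    rw [Finset.sum_eq_single a (fun b _ hb => by simp [hb]) (by simp)]
    simp
  rwa [key, key] at hu

variable [BorelSpace S] [IsFiniteMeasureOnCompacts μ] [μ.IsOpenPosMeasure]

theorem HasFunctionalDerivAt.unique_dQ {F : Phase k n N S → ℝ} {z : Phase k n N S}
    {A : Fin N → S → (Eucl n →L[ℝ] ℝ)} {B : Fin N → S → Eucl n}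
    {A' : Fin N → S → (Eucl n →L[ℝ] ℝ)} {B' : Fin N → S → Eucl n}
    (h : HasFunctionalDerivAt μ F z A B) (h' : HasFunctionalDerivAt μ F z A' B') : A = A' := by
  funext a
  by_contra hne
  obtain ⟨s₀, hs₀⟩ := Function.ne_iff.1 hne
  obtain ⟨v, hv⟩ : ∃ v, 0 < A a s₀ v - A' a s₀ v := by
    obtain ⟨v, hv⟩ := DFunLike.ne_iff.1 hs₀
    rcases (sub_ne_zero.2 hv).lt_or_gt with h1 | h1
    · exact ⟨-v, by rw [map_neg, map_neg]; linarith⟩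
    · exact ⟨v, h1⟩
  have hQ := (z a).emb.contMDiff.continuous
  have hA := (h.smooth_A a).continuous
  have hA' := (h'.smooth_A a).continuous
  have hU : {s | 0 < A a s v - A' a s v} ∈ 𝓝 s₀ :=
    (isOpen_lt continuous_const ((hA.clm_apply continuous_const).sub
      (hA'.clm_apply continuous_const))).mem_nhds hv
  -- `Q` is a topological embedding, so a small ball around `Q s₀` only meets the image of
  -- points near `s₀`.
  rw [(z a).emb.isEmbedding.isInducing.nhds_eq_comap, (Metric.nhds_basis_ball.comap _).mem_iff]
    at hU
  obtain ⟨r, hr, hball⟩ := hU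
  let χ : ContDiffBump ((z a).Q s₀) := ⟨r / 2, r, by linarith, by linarith⟩
  have hχ : ContDiff ℝ ∞ χ := χ.contDiff
  have hX : ContDiff ℝ ∞ (fun x => χ x • v) := hχ.smul contDiff_const
  have hXc : HasCompactSupport (fun x => χ x • v) := χ.hasCompactSupport.smul_right
  obtain ⟨C, hC⟩ := hX.lipschitzWith_of_hasCompactSupport hXc (by simp)
  have hint := h.integral_eq_of_moving_Q h' a hX hC
  have hXQ : Continuous (fun s => χ ((z a).Q s) • v) := hX.continuous.comp hQ
  have hi : Integrable (fun s => A a s (χ ((z a).Q s) • v)) μ :=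
    (hA.clm_apply hXQ).integrable_of_hasCompactSupport
      ((h.compact_A a).mono fun s hs h => hs (by simp [h]))
  have hi' : Integrable (fun s => A' a s (χ ((z a).Q s) • v)) μ :=
    (hA'.clm_apply hXQ).integrable_of_hasCompactSupport
      ((h'.compact_A a).mono fun s hs h => hs (by simp [h]))
  rw [← sub_eq_zero, ← integral_sub hi hi'] at hint
  refine hint.not_gt (Continuous.integral_pos_of_hasCompactSupport_nonneg_nonzero (x := s₀)
    ((hA.clm_apply hXQ).sub (hA'.clm_apply hXQ)) ?_ ?_ ?_)
  · refine HasCompactSupport.sub ?_ ?_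
    · exact (h.compact_A a).mono fun s hs h => hs (by simp [h])
    · exact (h'.compact_A a).mono fun s hs h => hs (by simp [h])
  · intro s
    simp only [map_smul, smul_eq_mul, ← mul_sub, Pi.zero_apply]
    by_cases hs : (z a).Q s ∈ Metric.ball ((z a).Q s₀) r
    · exact mul_nonneg χ.nonneg (le_of_lt (hball hs))
    · rw [χ.zero_of_le_dist (by simpa using hs), zero_mul]
  · simp only [map_smul, smul_eq_mul, ← mul_sub]
    rw [χ.one_of_mem_closedBall (Metric.mem_closedBall_self (by positivity)), one_mul]
    exact hv.ne'

theorem HasFunctionalDerivAt.unique_dP [T2Space S] [IsManifold (𝓡 k) ∞ S]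
    {F : Phase k n N S → ℝ} {z : Phase k n N S}
    {A : Fin N → S → (Eucl n →L[ℝ] ℝ)} {B : Fin N → S → Eucl n}
    {A' : Fin N → S → (Eucl n →L[ℝ] ℝ)} {B' : Fin N → S → Eucl n}
    (h : HasFunctionalDerivAt μ F z A B) (h' : HasFunctionalDerivAt μ F z A' B') : B = B' := by
  funext a
  by_contra hne
  obtain ⟨s₀, hs₀⟩ := Function.ne_iff.1 hne
  let f : SmoothBumpFunction (𝓡 k) s₀ := Classical.arbitrary _
  have hB := h.smooth_B a
  have hB' := h'.smooth_B a
  let W : S → (Eucl n →L[ℝ] ℝ) := fun s => f s • innerSL ℝ (B a s - B' a s)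
  have hW : ContMDiff (𝓡 k) 𝓘(ℝ, Eucl n →L[ℝ] ℝ) ∞ W :=
    f.contMDiff.smul ((innerSL ℝ (E := Eucl n)).contMDiff.comp (hB.sub hB'))
  have hWc : HasCompactSupport W := f.hasCompactSupport.smul_right
  have hWs : ∀ B : S → Eucl n, HasCompactSupport (fun s => W s (B s)) := fun B =>
    hWc.mono fun s hs h => hs (by simp [h])
  have hint := h.integral_eq_of_moving_P h' a hW hWc
  have hc := hW.continuous.clm_apply hB.continuous
  have hc' := hW.continuous.clm_apply hB'.continuous
  rw [← sub_eq_zero, ← integral_sub (hc.integrable_of_hasCompactSupport (hWs _))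
    (hc'.integrable_of_hasCompactSupport (hWs _))] at hint
  have hval : ∀ s, W s (B a s) - W s (B' a s) = f s * ‖B a s - B' a s‖ ^ 2 := by
    intro s
    rw [← map_sub, ← real_inner_self_eq_norm_sq]
    rfl
  refine hint.not_gt (Continuous.integral_pos_of_hasCompactSupport_nonneg_nonzero (x := s₀)
    (hc.sub hc') ((hWs _).sub (hWs _)) ?_ ?_)
  · intro s
    change 0 ≤ W s (B a s) - W s (B' a s)
    rw [hval]
    exact mul_nonneg f.nonneg (sq_nonneg _)
  · rw [hval, f.eq_one, one_mul]
    exact pow_ne_zero 2 (norm_ne_zero_iff.2 (sub_ne_zero.2 hs₀))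

theorem HasFunctionalDerivAt.dQ_eq {F : Phase k n N S → ℝ} {z : Phase k n N S}
    {A : Fin N → S → (Eucl n →L[ℝ] ℝ)} {B : Fin N → S → Eucl n}
    (h : HasFunctionalDerivAt μ F z A B) : dQ μ F z = A := by
  have h' : ∃ A B, HasFunctionalDerivAt μ F z A B := ⟨A, B, h⟩
  rw [dQ, dif_pos h']
  exact h'.choose_spec.choose_spec.unique_dQ h

theorem HasFunctionalDerivAt.dP_eq [T2Space S] [IsManifold (𝓡 k) ∞ S]
    {F : Phase k n N S → ℝ} {z : Phase k n N S}
    {A : Fin N → S → (Eucl n →L[ℝ] ℝ)} {B : Fin N → S → Eucl n}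
    (h : HasFunctionalDerivAt μ F z A B) : dP μ F z = B := by
  have h' : ∃ A B, HasFunctionalDerivAt μ F z A B := ⟨A, B, h⟩
  rw [dP, dif_pos h']
  exact h'.choose_spec.choose_spec.unique_dP h

end Phase

/-! ### The momentum map as a Poisson map -/

section MomentumMap

variable {k n N : ℕ} {S : Type*} [TopologicalSpace S] [ChartedSpace (EuclideanSpace ℝ (Fin k)) S]

theorem contMDiff_pairing_curve {z : ℝ → Phase k n N S} (hz : Phase.IsSmoothCurve z)
    (X : VectField n) (a : Fin N) :
    ContMDiff (𝓘(ℝ, ℝ).prod (𝓡 k)) 𝓘(ℝ, ℝ) ∞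
      (fun p : ℝ × S => (z p.1 a).P p.2 (X ((z p.1 a).Q p.2))) :=
  (hz.smooth_P a).clm_apply (X.smooth.contMDiff.comp (hz.smooth_Q a))

theorem compact_pairing_curve {z : ℝ → Phase k n N S} (hz : Phase.IsSmoothCurve z)
    (X : VectField n) (a : Fin N) (r : ℝ) :
    ∃ K : Set S, IsCompact K ∧ ∀ t ∈ Icc (-r) r, ∀ s ∉ K, (z t a).P s (X ((z t a).Q s)) = 0 := by
  obtain ⟨K, hK, h⟩ := hz.compact_P r
  exact ⟨K, hK, fun t ht s hs => by
    have h0 : (z t a).P s = 0 := h t ht a s hs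
    rw [h0, zero_apply]⟩

variable [MeasurableSpace S] [BorelSpace S] (μ : Measure S) [IsFiniteMeasureOnCompacts μ]

theorem JSing_apply (z : Phase k n N S) (X : VectField n) :
    JSing μ z X = ∑ a, ∫ s, (z a).P s (X ((z a).Q s)) ∂μ := by
  rw [JSing, sum_apply]
  rfl

variable [IsManifold (𝓡 k) ∞ S] [T2Space S]

theorem isSmoothCurve_JSing {z : ℝ → Phase k n N S} (hz : Phase.IsSmoothCurve z) :
    VectDual.IsSmoothCurve (fun t => JSing μ (z t)) := by
  intro X
  simp only [JSing_apply]
  exact ContDiff.sum fun a _ => contDiff_integral_time μ (contMDiff_pairing_curve hz X a)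
    (compact_pairing_curve hz X a)

theorem hasDerivAt_JSing {z : ℝ → Phase k n N S} (hz : Phase.IsSmoothCurve z)
    (X : VectField n) (t : ℝ) :
    HasDerivAt (fun τ => JSing μ (z τ) X)
      (∑ a, ∫ s, ((z t a).P s (fderiv ℝ X ((z t a).Q s) (deriv (fun τ => (z τ a).Q s) t))
        + (deriv (fun τ => (z τ a).P s) t) (X ((z t a).Q s))) ∂μ) t := by
  simp only [JSing_apply]
  have hint := HasDerivAt.fun_sum (u := Finset.univ) fun (a : Fin N) _ =>
    hasDerivAt_integral_time μ (contMDiff_pairing_curve hz X a) (compact_pairing_curve hz X a) t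
  refine hint.congr_deriv (Finset.sum_congr rfl fun a _ => ?_)
  symm
  refine integral_congr_ae (Eventually.of_forall fun s => ?_)
  have hQ : HasDerivAt (fun τ => (z τ a).Q s) (deriv (fun τ => (z τ a).Q s) t) t :=
    ((contMDiff_time_slice (hz.smooth_Q a) s).differentiable (by simp)).differentiableAt.hasDerivAt
  have hP : HasDerivAt (fun τ => (z τ a).P s) (deriv (fun τ => (z τ a).P s) t) t :=
    ((contMDiff_time_slice (hz.smooth_P a) s).differentiable (by simp)).differentiableAt.hasDerivAt
  have hX : HasFDerivAt (fun x => X x) (fderiv ℝ X ((z t a).Q s)) ((z t a).Q s) :=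
    (X.smooth.differentiable (by simp)).differentiableAt.hasFDerivAt
  exact (add_comm _ _).trans (hP.clm_apply (hX.comp_hasDerivAt t hQ)).deriv.symm

/-- The functional derivatives of `F ∘ J_Sing` are `Pᵃ ∘ Dξ(Qᵃ)` and `ξ(Qᵃ)`, with `ξ = δF/δm`. -/
theorem hasFunctionalDerivAt_comp_JSing {F : VectDual n → ℝ} (hF : VectDual.IsSmoothFun F)
    (z : Phase k n N S) :
    Phase.HasFunctionalDerivAt μ (fun w : Phase k n N S => F (JSing μ w)) z
      (fun a s => (z a).P s ∘L fderiv ℝ (VectDual.grad F (JSing μ z)) ((z a).Q s))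
      (fun a s => VectDual.grad F (JSing μ z) ((z a).Q s)) where
  smooth_A a := (z a).smooth_P.clm_comp
    (((VectDual.grad F (JSing μ z)).smooth.fderiv_right (m := ∞) le_rfl).contMDiff.comp
      (z a).emb.contMDiff)
  compact_A a := (z a).compact_P.mono fun s hs h => hs (by simp [h])
  smooth_B a := (VectDual.grad F (JSing μ z)).smooth.contMDiff.comp (z a).emb.contMDiff
  hasDerivAt c hc t hct := by
    have h := hF.hasFunctionalDerivAt (JSing μ z) _ (isSmoothCurve_JSing μ hc) t (by rw [hct])
    rw [(hasDerivAt_JSing μ hc _ t).deriv] at h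
    rw [hct] at h
    exact h

variable [μ.IsOpenPosMeasure]

theorem dQ_comp_JSing {F : VectDual n → ℝ} (hF : VectDual.IsSmoothFun F) (z : Phase k n N S) :
    Phase.dQ μ (fun w : Phase k n N S => F (JSing μ w)) z = fun a s =>
      (z a).P s ∘L fderiv ℝ (VectDual.grad F (JSing μ z)) ((z a).Q s) :=
  (hasFunctionalDerivAt_comp_JSing μ hF z).dQ_eq

theorem dP_comp_JSing {F : VectDual n → ℝ} (hF : VectDual.IsSmoothFun F) (z : Phase k n N S) :
    Phase.dP μ (fun w : Phase k n N S => F (JSing μ w)) z = fun a s =>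
      VectDual.grad F (JSing μ z) ((z a).Q s) :=
  (hasFunctionalDerivAt_comp_JSing μ hF z).dP_eq

theorem isSmoothFun_comp_JSing {F : VectDual n → ℝ} (hF : VectDual.IsSmoothFun F) :
    Phase.IsSmoothFun μ (fun w : Phase k n N S => F (JSing μ w)) where
  exists_deriv z := ⟨_, _, hasFunctionalDerivAt_comp_JSing μ hF z⟩
  smooth _ hc := hF.smooth _ (isSmoothCurve_JSing μ hc)
  smooth_dQ c hc a := by
    simp only [dQ_comp_JSing μ hF]
    have hg := hF.smooth_grad _ (isSmoothCurve_JSing μ hc)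
    have hfd : ContDiff ℝ ∞ (fun p : ℝ × Eucl n =>
        fderiv ℝ (VectDual.grad F (JSing μ (c p.1))) p.2) :=
      ContDiff.fderiv (f := fun (p : ℝ × Eucl n) y => VectDual.grad F (JSing μ (c p.1)) y)
        (hg.comp ((contDiff_fst.comp contDiff_fst).prodMk contDiff_snd)) contDiff_snd le_rfl
    exact (hc.smooth_P a).clm_comp
      (hfd.contMDiff.comp (contMDiff_fst.prodMk_space (hc.smooth_Q a)))
  compact_dQ c hc r := by
    obtain ⟨K, hK, h⟩ := hc.compact_P r
    refine ⟨K, hK, fun t ht a s hs => ?_⟩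
    have h0 : (c t a).P s = 0 := h t ht a s hs
    change Phase.dQ μ (fun w => F (JSing μ w)) (c t) a s = 0
    rw [dQ_comp_JSing μ hF]
    change (c t a).P s ∘L _ = 0
    rw [h0, ContinuousLinearMap.zero_comp]
  smooth_dP c hc a := by
    simp only [dP_comp_JSing μ hF]
    exact (hF.smooth_grad _ (isSmoothCurve_JSing μ hc)).contMDiff.comp
      (contMDiff_fst.prodMk_space (hc.smooth_Q a))

theorem bracket_comp_JSing {F G : VectDual n → ℝ} (hF : VectDual.IsSmoothFun F)
    (hG : VectDual.IsSmoothFun G) (z : Phase k n N S) :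
    Phase.bracket μ (fun w => F (JSing μ w)) (fun w => G (JSing μ w)) z
      = VectDual.bracket F G (JSing μ z) := by
  rw [Phase.bracket, VectDual.bracket, JSing_apply, dQ_comp_JSing μ hF, dQ_comp_JSing μ hG,
    dP_comp_JSing μ hF, dP_comp_JSing μ hG]
  refine Finset.sum_congr rfl fun a _ => integral_congr_ae (Eventually.of_forall fun s => ?_)
  simp [VectField.algBracket_apply]

/-- `[φ ∂ᵢ, ψ ∂ⱼ] = -φ (∂ᵢψ) ∂ⱼ + ψ (∂ⱼφ) ∂ᵢ` for the bracket of the diffeomorphism group. -/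
theorem algBracket_coord {n : ℕ} {φ ψ : Eucl n → ℝ} (hφ : ContDiff ℝ ∞ φ) (hψ : ContDiff ℝ ∞ ψ)
    (i j : Fin n) :
    VectField.algBracket (VectField.coord φ hφ i) (VectField.coord ψ hψ j)
      = - VectField.coord (fun x => φ x * partialDeriv i ψ x)
            (contDiff_mul_partialDeriv hφ hψ i) j
        + VectField.coord (fun x => ψ x * partialDeriv j φ x)
            (contDiff_mul_partialDeriv hψ hφ j) i := by
  have hfd : ∀ {φ : Eucl n → ℝ} (hφ : ContDiff ℝ ∞ φ) (i : Fin n) (x v : Eucl n),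
      fderiv ℝ (VectField.coord φ hφ i) x v
        = fderiv ℝ φ x v • EuclideanSpace.single i (1 : ℝ) := by
    intro φ hφ i x v
    have h1 : HasFDerivAt φ (fderiv ℝ φ x) x :=
      (hφ.differentiable (by simp)).differentiableAt.hasFDerivAt
    have h2 : HasFDerivAt (VectField.coord φ hφ i) _ x :=
      h1.smul_const (EuclideanSpace.single i (1 : ℝ))
    rw [h2.fderiv]
    rfl
  refine Subtype.ext (funext fun x => ?_)
  change VectField.algBracket (VectField.coord φ hφ i) (VectField.coord ψ hψ j) x
    = -((φ x * partialDeriv i ψ x) • EuclideanSpace.single j (1 : ℝ))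
      + (ψ x * partialDeriv j φ x) • EuclideanSpace.single i (1 : ℝ)
  rw [VectField.algBracket_apply, hfd, hfd]
  change fderiv ℝ φ x (ψ x • EuclideanSpace.single j (1 : ℝ)) • EuclideanSpace.single i (1 : ℝ)
    - fderiv ℝ ψ x (φ x • EuclideanSpace.single i (1 : ℝ)) • EuclideanSpace.single j (1 : ℝ) = _
  rw [map_smul, map_smul, smul_eq_mul, smul_eq_mul, partialDeriv, partialDeriv]
  abel

theorem hasDerivAt_comp_JSing_of_hamilton {h : VectDual n → ℝ} (hh : VectDual.IsSmoothFun h)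
    {z : ℝ → Phase k n N S} (hz : Phase.IsSmoothCurve z) {t : ℝ}
    (hQ : ∀ a s, deriv (fun τ => (z τ a).Q s) t
      = Phase.dP μ (fun w => h (JSing μ w)) (z t) a s)
    (hP : ∀ a s, deriv (fun τ => (z τ a).P s) t
      = - Phase.dQ μ (fun w => h (JSing μ w)) (z t) a s)
    {F : VectDual n → ℝ} (hF : VectDual.IsSmoothFun F) :
    HasDerivAt (fun τ => F (JSing μ (z τ))) (VectDual.bracket F h (JSing μ (z t))) t := by
  have hd := (hasFunctionalDerivAt_comp_JSing μ hF (z t)).hasDerivAt z hz t rfl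
  rw [← bracket_comp_JSing μ hF hh, Phase.bracket, dQ_comp_JSing μ hF, dP_comp_JSing μ hF]
  simpa only [hQ, hP, neg_apply, ← sub_eq_add_neg] using hd

end MomentumMap

end EPDiff

end

theorem corollary2 {k n N : ℕ} {S : Type*} [TopologicalSpace S]
    [ChartedSpace (EuclideanSpace ℝ (Fin k)) S] [IsManifold (𝓡 k) ∞ S] [T2Space S]
    [SecondCountableTopology S] [MeasurableSpace S] [BorelSpace S]
    (μ : Measure S) [IsFiniteMeasureOnCompacts μ] [μ.IsOpenPosMeasure] :
    -- `J_Sing` pulls smooth functions back to smooth functions and preserves Poisson brackets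
    (∀ F : EPDiff.VectDual n → ℝ, EPDiff.VectDual.IsSmoothFun F →
      EPDiff.Phase.IsSmoothFun μ (fun z : EPDiff.Phase k n N S => F (EPDiff.JSing μ z))) ∧
    (∀ F G : EPDiff.VectDual n → ℝ, EPDiff.VectDual.IsSmoothFun F →
      EPDiff.VectDual.IsSmoothFun G → ∀ z : EPDiff.Phase k n N S,
        EPDiff.Phase.bracket μ (fun w => F (EPDiff.JSing μ w)) (fun w => G (EPDiff.JSing μ w)) z
          = EPDiff.VectDual.bracket F G (EPDiff.JSing μ z)) ∧
    -- `{m_i(x), m_j(y)} = - (m_j(x) ∂/∂xⁱ + ∂/∂xʲ m_i(x)) δ(x - y)`, smeared with `φ(x) ψ(y)`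
    (∀ (φ ψ : EPDiff.Eucl n → ℝ) (hφ : ContDiff ℝ ∞ φ) (hψ : ContDiff ℝ ∞ ψ) (i j : Fin n)
      (z : EPDiff.Phase k n N S),
        EPDiff.Phase.bracket μ (fun w => EPDiff.JSing μ w (EPDiff.VectField.coord φ hφ i))
            (fun w => EPDiff.JSing μ w (EPDiff.VectField.coord ψ hψ j)) z
          = - EPDiff.JSing μ z (EPDiff.VectField.coord
                (fun x => φ x * EPDiff.partialDeriv i ψ x)
                (EPDiff.contDiff_mul_partialDeriv hφ hψ i) j)
            + EPDiff.JSing μ z (EPDiff.VectField.coord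
                (fun x => ψ x * EPDiff.partialDeriv j φ x)
                (EPDiff.contDiff_mul_partialDeriv hψ hφ j) i)) ∧
    -- canonical Hamiltonian dynamics of `h ∘ J_Sing` projects to Lie-Poisson dynamics of `h`
    (∀ h : EPDiff.VectDual n → ℝ, EPDiff.VectDual.IsSmoothFun h →
      ∀ z : ℝ → EPDiff.Phase k n N S, EPDiff.Phase.IsSmoothCurve z → ∀ t : ℝ,
        (∀ a s, deriv (fun τ => (z τ a).Q s) t
          = EPDiff.Phase.dP μ (fun w => h (EPDiff.JSing μ w)) (z t) a s) →
        (∀ a s, deriv (fun τ => (z τ a).P s) t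
          = - EPDiff.Phase.dQ μ (fun w => h (EPDiff.JSing μ w)) (z t) a s) →
        ∀ F : EPDiff.VectDual n → ℝ, EPDiff.VectDual.IsSmoothFun F →
          HasDerivAt (fun τ => F (EPDiff.JSing μ (z τ)))
            (EPDiff.VectDual.bracket F h (EPDiff.JSing μ (z t))) t) := by
  refine ⟨fun F hF => EPDiff.isSmoothFun_comp_JSing μ hF,
    fun F G hF hG z => EPDiff.bracket_comp_JSing μ hF hG z, fun φ ψ hφ hψ i j z => ?_,
    fun h hh z hz t hQ hP F hF => EPDiff.hasDerivAt_comp_JSing_of_hamilton μ hh hz hQ hP hF⟩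
  have h := EPDiff.bracket_comp_JSing μ
    (EPDiff.VectDual.isSmoothFun_apply (EPDiff.VectField.coord φ hφ i))
    (EPDiff.VectDual.isSmoothFun_apply (EPDiff.VectField.coord ψ hψ j)) z
  rw [h, EPDiff.VectDual.bracket, EPDiff.VectDual.grad_apply, EPDiff.VectDual.grad_apply,
    EPDiff.algBracket_coord, map_add, map_neg]
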